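/- For $n\ge 1$ let $\mathfrak S_n$ be the set of permutations of $[n]=\{1,\dots,n\}$, and for $\sigma\in\mathfrak S_n$ put $\sigma(n+1)=0$. Let $\mathrm{exc}\,\sigma$ be the number of $i\in[n]$ with $i<\sigma(i)$, let $\mathrm{inv}\,\sigma$ be the number of pairs $(i,j)$ with $1\le i<j\le n$ and $\sigma(i)>\sigma(j)$, and let $\mathrm{des}\,\sigma$ be the number of $i$ with $1\le i<n$ and $\sigma(i)>\sigma(i+1)$. Let $\mathrm{les}\,\sigma$ be the number of pairs $(i,j)$ with $2\le i<j\le n$ and $\sigma(i-1)>\sigma(j)>\sigma(i)$, and let $\mathrm{res}\,\sigma$ be the number of pairs $(i,j)$ with $1\le i<j\le n-1$ and $\sigma(j+1)>\sigma(i)>\sigma(j)$. Let $\mathrm{DD}_{n,k}$ be the set of $\sigma\in\mathfrak S_n$ with $\mathrm{des}\,\sigma=k$ for which there is no $i$ with $1<i\le n$ and $\sigma(i-1)>\sigma(i)>\sigma(i+1)$. Theorem. Let $n\ge 1$, and for $k\ge 0$ put $\gamma_{n,k}(q)=\sum_{\sigma\in\mathrm{DD}_{n,k}}q^{2\,\mathrm{res}\,\sigma+\mathrm{les}\,\sigma}$.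 Then $\mathrm{inv}\,\sigma\ge\mathrm{exc}\,\sigma$ for every $\sigma\in\mathfrak S_n$, and $$\sum_{\sigma\in\mathfrak S_n}t^{\mathrm{exc}\,\sigma}q^{\mathrm{inv}\,\sigma-\mathrm{exc}\,\sigma}=\sum_{0\le k\le (n-1)/2}\gamma_{n,k}(q)\,t^k(1+t)^{n-1-2k}$$ in $\mathbb Z[q,t]$. Moreover, for every $0\le k\le (n-1)/2$, the polynomial $\gamma_{n,k}(q)$ is divisible by $q^k(1+q)^k$ in $\mathbb Z[q]$. -/

import Mathlib

open Polynomial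

/-- The word of a permutation `σ` of `[n]`, with letters and positions numbered from `1`:
`word σ i` is the letter `σ(i) ∈ {1, …, n}` for `1 ≤ i ≤ n`. At every other position its value
is `0`; in particular `σ(n + 1) = 0`. -/
def word {n : ℕ} (σ : Equiv.Perm (Fin n)) (i : ℕ) : ℕ :=
  if h : 1 ≤ i ∧ i ≤ n then (σ ⟨i - 1, by omega⟩ : ℕ) + 1 else 0

/-- The number of excedances: positions `i ∈ [n]` with `i < σ(i)`. -/
def exc {n : ℕ} (σ : Equiv.Perm (Fin n)) : ℕ :=
  (Finset.univ.filter fun i : Fin n => i < σ i).card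

/-- The number of inversions: pairs `(i, j)` with `i < j` and `σ(i) > σ(j)`. -/
def inv {n : ℕ} (σ : Equiv.Perm (Fin n)) : ℕ :=
  (Finset.univ.filter fun p : Fin n × Fin n => p.1 < p.2 ∧ σ p.2 < σ p.1).card

/-- The number of descents: positions `1 ≤ i < n` with `σ(i) > σ(i + 1)`. -/
def des {n : ℕ} (σ : Equiv.Perm (Fin n)) : ℕ :=
  ((Finset.Ico 1 n).filter fun i => word σ i > word σ (i + 1)).card

/-- The number of double descents of the word `σ(1) … σ(n) 0`: positions `1 < i ≤ n` with
`σ(i - 1) > σ(i) > σ(i + 1)`, where `σ(n + 1) = 0`. -/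
def ddZero {n : ℕ} (σ : Equiv.Perm (Fin n)) : ℕ :=
  ((Finset.Icc 2 n).filter fun i =>
    word σ (i - 1) > word σ i ∧ word σ i > word σ (i + 1)).card

/-- The number of pairs `(i, j)` with `2 ≤ i < j ≤ n` and `σ(i - 1) > σ(j) > σ(i)`. -/
def les {n : ℕ} (σ : Equiv.Perm (Fin n)) : ℕ :=
  ((Finset.Icc 2 n ×ˢ Finset.Icc 2 n).filter fun p =>
    p.1 < p.2 ∧ word σ (p.1 - 1) > word σ p.2 ∧ word σ p.2 > word σ p.1).card

/-- The number of pairs `(i, j)` with `1 ≤ i < j ≤ n - 1` and `σ(j + 1) > σ(i) > σ(j)`. -/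
def res {n : ℕ} (σ : Equiv.Perm (Fin n)) : ℕ :=
  ((Finset.Ico 1 n ×ˢ Finset.Ico 1 n).filter fun p =>
    p.1 < p.2 ∧ word σ (p.2 + 1) > word σ p.1 ∧ word σ p.1 > word σ p.2).card

/-- The set of permutations of `[n]` with exactly `k` descents and such that the word
`σ(1) … σ(n) 0` has no double descent. -/
def DD (n k : ℕ) : Finset (Equiv.Perm (Fin n)) :=
  Finset.univ.filter fun σ => des σ = k ∧ ddZero σ = 0

/-- The polynomial `γ_{n,k}(q) = ∑_{σ ∈ DD_{n,k}} q ^ (2 res σ + les σ)` in `ℤ[q]`. -/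
noncomputable def gammaPoly (n k : ℕ) : ℤ[X] :=
  ∑ σ ∈ DD n k, X ^ (2 * res σ + les σ)

/-! Both sides count the same weighted Motzkin paths (`motzkinSum`). With `w h = q^h (1 + q + ⋯ +
q^h)` (`stepWeight`), a level step at height `h` weighs `y * w h`, an up step from `h` weighs `x * w
h * w (h + 1)`, a down step weighs `1`.

For `exc` and `inv - exc`, consider permutations whose graph avoids the rectangle of the first `a`
positions and first `b` values (`avoidSum`). Enlarging `(h, h + 1)` to `(h + 1, h + 1)` and then to
`(h + 1, h + 2)` excludes the permutations with a point in the new strip. A strip lies in one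
position or one value, so this point is unique; deleting it leaves a permutation avoiding a smaller
rectangle, at cost `w h` or `t * w h`. Together these steps are the Motzkin recursion with `x = t`,
`y = 1 + t` (`avoidSum_eq_motzkinSum`).

For `gammaPoly`, build the word by inserting letters in increasing order, marking the gaps that will
later receive larger letters. With `h + 1` marked gaps, the choice of gap contributes `w h`; the new
letter, as a peak, double ascent or valley, changes the number of marks by `-1`, `0` or `1`, and
double descents weigh `0` (`markedSum_succ`, `sum_markedWeight`).

Hence the path sum at `x = t` is `∑ γ_{n,k} t^k y^(n-1-2k)` for every `y`. Taking `y = 1 + t` gives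
the identity. Taking `y = 1` makes `γ_{n,k}` the coefficient of `t^k`, and each up step carries `w h
* w (h + 1)`, a multiple of `q (1 + q)`. -/

/-! ### Inserting and deleting a point of a permutation. -/

/-- The permutation obtained from `τ` by inserting the value `v` at the position `p`, keeping
the relative order of the other positions and values. -/
def insertPerm {n : ℕ} (p v : Fin (n + 1)) (τ : Equiv.Perm (Fin n)) : Equiv.Perm (Fin (n + 1)) :=
  (finSuccEquiv' p).trans ((Equiv.optionCongr τ).trans (finSuccEquiv' v).symm)

@[simp] lemma insertPerm_same {n : ℕ} (p v : Fin (n + 1)) (τ : Equiv.Perm (Fin n)) :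
    insertPerm p v τ p = v := by
  simp [insertPerm]

@[simp] lemma insertPerm_succAbove {n : ℕ} (p v : Fin (n + 1)) (τ : Equiv.Perm (Fin n))
    (i : Fin n) : insertPerm p v τ (p.succAbove i) = v.succAbove (τ i) := by
  simp [insertPerm]

lemma exists_eq_insertPerm {n : ℕ} (p : Fin (n + 1)) (σ : Equiv.Perm (Fin (n + 1))) :
    ∃ τ, insertPerm p (σ p) τ = σ := by
  let e : Option (Fin n) ≃ Option (Fin n) :=
    (finSuccEquiv' p).symm.trans (σ.trans (finSuccEquiv' (σ p)))
  have he : e none = none := by simp [e]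
  refine ⟨Equiv.removeNone e, ?_⟩
  ext i : 1
  rcases Fin.eq_self_or_eq_succAbove p i with rfl | ⟨j, rfl⟩
  · simp
  · rw [insertPerm_succAbove]
    have h1 : some (Equiv.removeNone e j) = e (some j) := by
      apply Equiv.removeNone_some
      by_contra h
      have : e (some j) = none := by
        cases hh : e (some j) with
        | none => rfl
        | some a => exact absurd ⟨a, hh⟩ h
      rw [← he] at this
      simpa using e.injective this
    have h2 := congrArg (finSuccEquiv' (σ p)).symm h1
    simpa [e] using h2

lemma insertPerm_injective {n : ℕ} (p v : Fin (n + 1)) :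
    Function.Injective (insertPerm p v) := by
  intro τ τ' h
  ext i : 1
  have := congrArg (fun σ => σ (p.succAbove i)) h
  simpa using this

lemma sum_perm_insert_position {n : ℕ} {R : Type*} [AddCommMonoid R] (p : Fin (n + 1))
    (f : Equiv.Perm (Fin (n + 1)) → R) :
    ∑ σ, f σ = ∑ v, ∑ τ, f (insertPerm p v τ) := by
  rw [← Fintype.sum_prod_type']
  symm
  refine Fintype.sum_bijective (fun x : Fin (n + 1) × Equiv.Perm (Fin n) => insertPerm p x.1 x.2)
    ⟨?_, ?_⟩ _ _ (fun _ => rfl)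
  · rintro ⟨v, τ⟩ ⟨v', τ'⟩ h
    have hv : v = v' := by simpa using congrArg (fun σ => σ p) h
    subst hv
    simpa using insertPerm_injective p v h
  · intro σ
    obtain ⟨τ, h⟩ := exists_eq_insertPerm p σ
    exact ⟨(σ p, τ), h⟩

lemma sum_perm_insert_value {n : ℕ} {R : Type*} [AddCommMonoid R] (v : Fin (n + 1))
    (f : Equiv.Perm (Fin (n + 1)) → R) :
    ∑ σ, f σ = ∑ p, ∑ τ, f (insertPerm p v τ) := by
  rw [← Fintype.sum_prod_type']
  symm
  refine Fintype.sum_bijective (fun x : Fin (n + 1) × Equiv.Perm (Fin n) => insertPerm x.1 v x.2)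
    ⟨?_, ?_⟩ _ _ (fun _ => rfl)
  · rintro ⟨p, τ⟩ ⟨p', τ'⟩ h
    have hv : p = p' := by
      have h1 : insertPerm p v τ p = v := by simp
      have h2 : insertPerm p' v τ' p' = v := by simp
      have h3 : insertPerm p v τ = insertPerm p' v τ' := h
      rw [← h3] at h2
      exact (insertPerm p v τ).injective (h1.trans h2.symm)
    subst hv
    simpa using insertPerm_injective p v h
  · intro σ
    obtain ⟨τ, h⟩ := exists_eq_insertPerm (σ.symm v) σ
    refine ⟨(σ.symm v, τ), ?_⟩
    simpa using h

lemma exc_eq_sum {n : ℕ} (σ : Equiv.Perm (Fin n)) :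
    exc σ = ∑ i, if i < σ i then 1 else 0 := by
  rw [exc, Finset.card_filter]

lemma inv_eq_sum {n : ℕ} (σ : Equiv.Perm (Fin n)) :
    inv σ = ∑ i, ∑ j, if i < j ∧ σ j < σ i then 1 else 0 := by
  rw [inv, Finset.card_filter, Fintype.sum_prod_type]

lemma exc_insertPerm {n : ℕ} (p v : Fin (n + 1)) (τ : Equiv.Perm (Fin n)) :
    exc (insertPerm p v τ) = (if p < v then 1 else 0) +
      ∑ i, if p.succAbove i < v.succAbove (τ i) then 1 else 0 := by
  rw [exc_eq_sum, Fin.sum_univ_succAbove _ p]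
  simp

lemma inv_insertPerm {n : ℕ} (p v : Fin (n + 1)) (τ : Equiv.Perm (Fin n)) :
    inv (insertPerm p v τ) = inv τ +
      (∑ i, if p < p.succAbove i ∧ v.succAbove (τ i) < v then 1 else 0) +
      ∑ i, if p.succAbove i < p ∧ v < v.succAbove (τ i) then 1 else 0 := by
  rw [inv_eq_sum, Fin.sum_univ_succAbove _ p]
  simp_rw [Fin.sum_univ_succAbove _ p]
  rw [Finset.sum_add_distrib, inv_eq_sum]
  simp only [insertPerm_same, insertPerm_succAbove, lt_self_iff_false, false_and, if_false,
    zero_add, Fin.succAbove_lt_succAbove_iff]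
  ring

/-- Pigeonhole: otherwise `σ` injects the positions after `i` into the values above `σ i`, which are
fewer. -/
lemma exists_lt_of_lt_apply {n : ℕ} (σ : Equiv.Perm (Fin n)) (i : Fin n) (h : i < σ i) :
    ∃ j, i < j ∧ σ j < σ i := by
  by_contra! hc
  have h1 : (Finset.Ioi i).image σ ⊆ Finset.Ioi (σ i) := by
    intro x hx
    obtain ⟨j, hj, rfl⟩ := Finset.mem_image.1 hx
    rw [Finset.mem_Ioi] at hj ⊢
    exact lt_of_le_of_ne (hc j hj) fun e => hj.ne (σ.injective e)
  have h2 := Finset.card_le_card h1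
  rw [Finset.card_image_of_injective _ σ.injective, Fin.card_Ioi, Fin.card_Ioi] at h2
  have := (σ i).isLt
  omega

lemma exc_le_inv {n : ℕ} (σ : Equiv.Perm (Fin n)) : exc σ ≤ inv σ := by
  rw [exc_eq_sum, inv_eq_sum]
  refine Finset.sum_le_sum fun i _ => ?_
  split_ifs with h
  · obtain ⟨j, hj⟩ := exists_lt_of_lt_apply σ i h
    refine le_trans ?_ (Finset.single_le_sum (fun _ _ => Nat.zero_le _) (Finset.mem_univ j))
    simp [hj]
  · exact Nat.zero_le _

lemma sum_apply_lt {n h : ℕ} (τ : Equiv.Perm (Fin n)) (hn : h ≤ n) :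
    (∑ i, if (τ i : ℕ) < h then 1 else 0) = h := by
  rw [Equiv.sum_comp τ (fun i : Fin n => if (i : ℕ) < h then 1 else 0), ← Finset.card_filter,
    Fin.card_filter_val_lt]
  omega

lemma sum_val_lt {n h : ℕ} (hn : h ≤ n) :
    (∑ i : Fin n, if (i : ℕ) < h then 1 else 0) = h :=
  sum_apply_lt 1 hn

lemma val_succAbove {n : ℕ} (p : Fin (n + 1)) (i : Fin n) :
    (p.succAbove i : ℕ) = if (i : ℕ) < p then (i : ℕ) else i + 1 := by
  rw [Fin.succAbove]
  split_ifs with h1 h2 h2 <;> simp_all [Fin.lt_def]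

/-! ### Permutations avoiding a rectangle, and deletion of a point in a boundary strip. -/

/-- `σ` maps each of the first `a` positions to a value that is not among the first `b`. -/
def Avoids {n : ℕ} (a b : ℕ) (σ : Equiv.Perm (Fin n)) : Prop :=
  ∀ j : Fin n, (j : ℕ) < a → b ≤ (σ j : ℕ)

instance {n a b : ℕ} (σ : Equiv.Perm (Fin n)) : Decidable (Avoids a b σ) := by
  unfold Avoids; infer_instance

lemma exc_insertPerm_of_lt {n k : ℕ} {p v : Fin (n + 1)} {τ : Equiv.Perm (Fin n)}
    (hp : (p : ℕ) ≤ k) (hv : (v : ℕ) = k + 1) (hτ : Avoids k (k + 1) τ) :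
    exc (insertPerm p v τ) = exc τ + 1 := by
  rw [exc_insertPerm, exc_eq_sum, if_pos (Fin.lt_def.2 (by omega)), add_comm]
  congr 1
  refine Finset.sum_congr rfl fun i _ => ?_
  have := hτ i
  congr 1
  simp only [Fin.lt_def, val_succAbove, eq_iff_iff]
  split_ifs <;> omega

/-- The `k + 1` smaller values all sit at positions `≥ k` of `τ`, hence to the right of the new
point; the `p` letters before it are all larger. -/
lemma inv_insertPerm_of_lt {n k : ℕ} {p v : Fin (n + 1)} {τ : Equiv.Perm (Fin n)}
    (hp : (p : ℕ) ≤ k) (hv : (v : ℕ) = k + 1) (hτ : Avoids k (k + 1) τ) :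
    inv (insertPerm p v τ) = inv τ + (k + 1) + p := by
  have hvn := v.isLt
  have e1 := sum_apply_lt τ (h := k + 1) (by omega)
  have e2 := sum_val_lt (n := n) (h := p) (by omega)
  rw [inv_insertPerm]
  conv_rhs => rw [← e1, ← e2]
  congr 1
  · congr 1
    refine Finset.sum_congr rfl fun i _ => ?_
    have := hτ i
    congr 1
    simp only [Fin.lt_def, val_succAbove, eq_iff_iff]
    split_ifs <;> omega
  · refine Finset.sum_congr rfl fun i _ => ?_
    have := hτ i
    congr 1
    simp only [Fin.lt_def, val_succAbove, eq_iff_iff]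
    split_ifs <;> omega

lemma exc_insertPerm_of_ge {n h : ℕ} {p v : Fin (n + 1)} {τ : Equiv.Perm (Fin n)}
    (hp : (p : ℕ) = h) (hv : (v : ℕ) ≤ h) (hτ : Avoids h h τ) :
    exc (insertPerm p v τ) = exc τ := by
  rw [exc_insertPerm, exc_eq_sum, if_neg (by rw [Fin.lt_def]; omega), zero_add]
  refine Finset.sum_congr rfl fun i _ => ?_
  have := hτ i
  congr 1
  simp only [Fin.lt_def, val_succAbove, eq_iff_iff]
  split_ifs <;> omega

/-- The `h` letters before the new point are all larger; the `v` smaller values all lie after it. -/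
lemma inv_insertPerm_of_ge {n h : ℕ} {p v : Fin (n + 1)} {τ : Equiv.Perm (Fin n)}
    (hp : (p : ℕ) = h) (hv : (v : ℕ) ≤ h) (hτ : Avoids h h τ) :
    inv (insertPerm p v τ) = inv τ + v + h := by
  have hpn := p.isLt
  have e1 := sum_apply_lt τ (h := v) (by omega)
  have e2 := sum_val_lt (n := n) (h := h) (by omega)
  rw [inv_insertPerm]
  conv_rhs => rw [← e1, ← e2]
  congr 1
  · congr 1
    refine Finset.sum_congr rfl fun i _ => ?_
    have := hτ i
    congr 1
    simp only [Fin.lt_def, val_succAbove, eq_iff_iff]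
    split_ifs <;> omega
  · refine Finset.sum_congr rfl fun i _ => ?_
    have := hτ i
    congr 1
    simp only [Fin.lt_def, val_succAbove, eq_iff_iff]
    split_ifs <;> omega

/-- The left side says that the value `k + 1` is what violates the larger rectangle, so it occupies
one of the first `k + 1` positions. -/
lemma avoids_insertPerm_of_lt {n k : ℕ} {p v : Fin (n + 1)} {τ : Equiv.Perm (Fin n)}
    (hv : (v : ℕ) = k + 1) :
    Avoids (k + 1) (k + 1) (insertPerm p v τ) ∧ ¬ Avoids (k + 1) (k + 2) (insertPerm p v τ) ↔
      (p : ℕ) ≤ k ∧ Avoids k (k + 1) τ := by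
  constructor
  · rintro ⟨h1, h2⟩
    have hp : (p : ℕ) ≤ k := by
      by_contra hc
      apply h2
      intro j hj
      rcases Fin.eq_self_or_eq_succAbove p j with rfl | ⟨i, rfl⟩
      · omega
      · have := h1 _ hj
        rw [insertPerm_succAbove] at this ⊢
        rw [val_succAbove] at this ⊢
        split_ifs at * <;> omega
    refine ⟨hp, fun i hi => ?_⟩
    have := h1 (p.succAbove i) (by rw [val_succAbove]; split_ifs <;> omega)
    rw [insertPerm_succAbove, val_succAbove] at this
    split_ifs at * <;> omega
  · rintro ⟨hp, h1⟩
    refine ⟨fun j hj => ?_, fun h2 => ?_⟩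
    · rcases Fin.eq_self_or_eq_succAbove p j with rfl | ⟨i, rfl⟩
      · simp [hv]
      · rw [insertPerm_succAbove, val_succAbove]
        rw [val_succAbove] at hj
        have := h1 i
        split_ifs at * <;> omega
    · have := h2 p (by omega)
      rw [insertPerm_same] at this
      omega

lemma avoids_insertPerm_of_ge {n h : ℕ} {p v : Fin (n + 1)} {τ : Equiv.Perm (Fin n)}
    (hp : (p : ℕ) = h) :
    Avoids h (h + 1) (insertPerm p v τ) ∧ ¬ Avoids (h + 1) (h + 1) (insertPerm p v τ) ↔
      (v : ℕ) ≤ h ∧ Avoids h h τ := by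
  constructor
  · rintro ⟨h1, h2⟩
    have hp : (v : ℕ) ≤ h := by
      by_contra hc
      apply h2
      intro j hj
      rcases Fin.eq_self_or_eq_succAbove p j with rfl | ⟨i, rfl⟩
      · rw [insertPerm_same]; omega
      · apply h1
        rw [val_succAbove] at hj ⊢
        split_ifs at * <;> omega
    refine ⟨hp, fun i hi => ?_⟩
    have := h1 (p.succAbove i) (by rw [val_succAbove]; split_ifs <;> omega)
    rw [insertPerm_succAbove, val_succAbove] at this
    split_ifs at * <;> omega
  · rintro ⟨hv, h1⟩
    refine ⟨fun j hj => ?_, fun h2 => ?_⟩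
    · rcases Fin.eq_self_or_eq_succAbove p j with rfl | ⟨i, rfl⟩
      · omega
      · rw [insertPerm_succAbove, val_succAbove]
        rw [val_succAbove] at hj
        have := h1 i
        split_ifs at * <;> omega
    · have := h2 p (by omega)
      rw [insertPerm_same] at this
      omega

lemma Avoids.mono {n a b a' b' : ℕ} {σ : Equiv.Perm (Fin n)} (h : Avoids a b σ) (ha : a' ≤ a)
    (hb : b' ≤ b) : Avoids a' b' σ :=
  fun j hj => hb.trans (h j (by omega))

/-! ### The Motzkin recursion for excedances and inversions. -/

section Recursion

variable {R : Type*} [CommRing R] (q t x y : R)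

/-- The polynomial `q ^ h * (1 + q + ⋯ + q ^ h)`. -/
def stepWeight (h : ℕ) : R := q ^ h * ∑ r ∈ Finset.range (h + 1), q ^ r

/-- The generating function of `exc` and `inv - exc` over the permutations of `[n]` that avoid a
rectangle. -/
def avoidSum (n a b : ℕ) : R :=
  ∑ σ : Equiv.Perm (Fin n), if Avoids a b σ then t ^ exc σ * q ^ (inv σ - exc σ) else 0

lemma ite_eq_add_ite {P Q : Prop} [Decidable P] [Decidable Q] (h : Q → P) (a : R) :
    (if P then a else 0) = (if Q then a else 0) + if P ∧ ¬ Q then a else 0 := by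
  by_cases hQ : Q
  · simp [hQ, h hQ]
  · simp [hQ]

lemma sum_fin_le_eq {n k : ℕ} (hk : k ≤ n) (f : ℕ → R) :
    (∑ p : Fin (n + 1), if (p : ℕ) ≤ k then f p else 0) = ∑ r ∈ Finset.range (k + 1), f r := by
  rw [Fin.sum_univ_eq_sum_range (fun p => if p ≤ k then f p else 0), ← Finset.sum_filter]
  congr 1
  ext r
  simp only [Finset.mem_filter, Finset.mem_range]
  omega

/-- The excluded permutations have the value `k + 1` at some position `p ≤ k`. Deleting it removes
one excedance and `k + 1 + p` inversions, a factor `t * q ^ (k + p)`. -/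
lemma avoidSum_value_step {n k : ℕ} (hk : k + 1 ≤ n) :
    avoidSum q t (n + 1) (k + 1) (k + 1) = avoidSum q t (n + 1) (k + 1) (k + 2) +
      t * stepWeight q k * avoidSum q t n k (k + 1) := by
  conv_lhs => rw [avoidSum]
  rw [Finset.sum_congr rfl fun σ _ => ite_eq_add_ite
    (fun h : Avoids (k + 1) (k + 2) σ => h.mono le_rfl (Nat.le_succ _)) _,
    Finset.sum_add_distrib, ← avoidSum]
  congr 1
  rw [sum_perm_insert_value ⟨k + 1, by omega⟩, stepWeight, Finset.mul_sum, Finset.mul_sum,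
    ← sum_fin_le_eq (n := n) (by omega), Finset.sum_mul]
  refine Finset.sum_congr rfl fun p _ => ?_
  rw [avoidSum, Finset.mul_sum]
  refine Finset.sum_congr rfl fun τ _ => ?_
  simp only [avoids_insertPerm_of_lt (v := (⟨k + 1, by omega⟩ : Fin (n + 1))) rfl]
  by_cases hp : (p : ℕ) ≤ k
  · by_cases hτ : Avoids k (k + 1) τ
    · rw [if_pos ⟨hp, hτ⟩, if_pos hp, if_pos hτ, exc_insertPerm_of_lt hp rfl hτ,
        inv_insertPerm_of_lt hp rfl hτ]
      -- Needed because the exponent is a truncated subtraction.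
      have := exc_le_inv τ
      rw [show inv τ + (k + 1) + p - (exc τ + 1) = (inv τ - exc τ) + k + p by omega]
      ring
    · simp [hτ]
  · simp [hp]

/-- The excluded permutations have a value `v ≤ h` at position `h`. Deleting it removes no excedance
and `v + h` inversions. -/
lemma avoidSum_position_step {n h : ℕ} (hn : h ≤ n) :
    avoidSum q t (n + 1) h (h + 1) = avoidSum q t (n + 1) (h + 1) (h + 1) +
      stepWeight q h * avoidSum q t n h h := by
  conv_lhs => rw [avoidSum]
  rw [Finset.sum_congr rfl fun σ _ => ite_eq_add_ite
    (fun h' : Avoids (h + 1) (h + 1) σ => h'.mono (Nat.le_succ _) le_rfl) _,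
    Finset.sum_add_distrib, ← avoidSum]
  congr 1
  rw [sum_perm_insert_position ⟨h, by omega⟩, stepWeight, Finset.mul_sum,
    ← sum_fin_le_eq (n := n) (by omega), Finset.sum_mul]
  refine Finset.sum_congr rfl fun v _ => ?_
  rw [avoidSum, Finset.mul_sum]
  refine Finset.sum_congr rfl fun τ _ => ?_
  simp only [avoids_insertPerm_of_ge (p := (⟨h, by omega⟩ : Fin (n + 1))) rfl]
  by_cases hp : (v : ℕ) ≤ h
  · by_cases hτ : Avoids h h τ
    · rw [if_pos ⟨hp, hτ⟩, if_pos hp, if_pos hτ, exc_insertPerm_of_ge rfl hp hτ,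
        inv_insertPerm_of_ge rfl hp hτ]
      have := exc_le_inv τ
      rw [show inv τ + v + h - exc τ = (inv τ - exc τ) + v + h by omega]
      ring
    · simp [hτ]
  · simp [hp]

lemma avoidSum_zero_left (n b : ℕ) :
    avoidSum q t n 0 b = ∑ σ : Equiv.Perm (Fin n), t ^ exc σ * q ^ (inv σ - exc σ) := by
  refine Finset.sum_congr rfl fun σ _ => if_pos ?_
  intro j hj
  omega

lemma avoidSum_eq_zero {n a b : ℕ} (ha : 1 ≤ a) (hn : 1 ≤ n) (hb : n ≤ b) :
    avoidSum q t n a b = 0 := by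
  refine Finset.sum_eq_zero fun σ _ => if_neg fun h => ?_
  have h1 := h ⟨0, hn⟩ ha
  have h2 := (σ ⟨0, hn⟩).isLt
  omega

lemma avoidSum_zero : avoidSum q t 0 0 0 = 1 := by
  rw [avoidSum_zero_left]
  simp [exc, inv]

/-- The generating function of the weighted Motzkin paths of length `m` from height `h` to
height `0`. -/
def motzkinSum : ℕ → ℕ → R
  | 0, h => if h = 0 then 1 else 0
  | m + 1, 0 => y * stepWeight q 0 * motzkinSum m 0 +
      x * (stepWeight q 0 * stepWeight q 1) * motzkinSum m 1
  | m + 1, h + 1 => motzkinSum m h + y * stepWeight q (h + 1) * motzkinSum m (h + 1) +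
      x * (stepWeight q (h + 1) * stepWeight q (h + 2)) * motzkinSum m (h + 2)

/-- Chaining the two steps, non-excedances and excedances each give a level step, whence `1 + t`.
The products renormalize so that down steps weigh `1`. -/
lemma avoidSum_eq_motzkinSum (m h : ℕ) :
    avoidSum q t (h + m + 1) h (h + 1) =
      ((∏ i ∈ Finset.range h, t * stepWeight q i) * ∏ i ∈ Finset.range (h + 1), stepWeight q i) *
        motzkinSum q t (1 + t) m h := by
  induction m generalizing h with
  | zero =>
    rw [avoidSum_position_step _ _ (by omega), avoidSum_eq_zero _ _ (by omega) (by omega) (by omega)]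
    cases h with
    | zero => simp [avoidSum_zero, motzkinSum]
    | succ h => simp [avoidSum_eq_zero _ _ (a := h + 1) (n := h + 1) (b := h + 1), motzkinSum]
  | succ m ih =>
    rw [avoidSum_position_step _ _ (by omega)]
    have h1 := avoidSum_value_step q t (n := h + (m + 1)) (k := h) (by omega)
    rw [h1, show h + (m + 1) + 1 = (h + 1) + m + 1 by ring, ih,
      show h + (m + 1) = h + m + 1 by ring, ih]
    cases h with
    | zero =>
      -- A rectangle with no positions is no constraint, so the down step is absent at height `0`.
      have h2 : avoidSum q t (0 + m + 1) 0 0 = avoidSum q t (0 + m + 1) 0 (0 + 1) := by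
        rw [avoidSum_zero_left, avoidSum_zero_left]
      rw [h2, ih, motzkinSum]
      simp only [Finset.prod_range_succ, Finset.prod_range_zero]
      ring
    | succ h =>
      rw [avoidSum_value_step q t (by omega), ih, show h + 1 + m = h + m + 1 by ring, ih, motzkinSum]
      simp only [Finset.prod_range_succ]
      ring

theorem sum_exc_inv_eq_motzkinSum (m : ℕ) :
    ∑ σ : Equiv.Perm (Fin (m + 1)), t ^ exc σ * q ^ (inv σ - exc σ) =
      motzkinSum q t (1 + t) m 0 := by
  have := avoidSum_eq_motzkinSum q t m 0
  rw [avoidSum_zero_left, show 0 + m + 1 = m + 1 by ring] at this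
  rw [this]
  simp [stepWeight]

end Recursion

/-! ### The word after insertion of its largest letter. -/

lemma word_val_succ {n : ℕ} (σ : Equiv.Perm (Fin n)) (i : Fin n) :
    word σ ((i : ℕ) + 1) = (σ i : ℕ) + 1 := by
  rw [word, dif_pos ⟨by omega, by omega⟩]
  rfl

@[simp] lemma word_zero {n : ℕ} (σ : Equiv.Perm (Fin n)) : word σ 0 = 0 := by
  rw [word, dif_neg (by omega)]

lemma word_of_gt {n : ℕ} (σ : Equiv.Perm (Fin n)) {k : ℕ} (h : n < k) : word σ k = 0 := by
  rw [word, dif_neg (by omega)]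

lemma word_le {n : ℕ} (σ : Equiv.Perm (Fin n)) (k : ℕ) : word σ k ≤ n := by
  rw [word]
  split_ifs
  · exact (σ _).isLt
  · exact Nat.zero_le _

lemma word_insertPerm_of_le {n : ℕ} (p : Fin (n + 1)) (τ : Equiv.Perm (Fin n)) {k : ℕ}
    (hk : k ≤ p) : word (insertPerm p (Fin.last n) τ) k = word τ k := by
  rcases k with _ | k
  · simp
  · have hp := p.isLt
    have h1 : p.succAbove ⟨k, by omega⟩ = ⟨k, by omega⟩ := by
      ext
      rw [val_succAbove, if_pos (by simpa using hk)]
    have h2 := word_val_succ (insertPerm p (Fin.last n) τ) ⟨k, by omega⟩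
    have h3 := word_val_succ τ ⟨k, by omega⟩
    rw [← h1, insertPerm_succAbove, Fin.succAbove_last, h1] at h2
    exact h2.trans h3.symm

lemma word_insertPerm_of_gt {n : ℕ} (p : Fin (n + 1)) (τ : Equiv.Perm (Fin n)) {k : ℕ}
    (hk : (p : ℕ) < k) : word (insertPerm p (Fin.last n) τ) (k + 1) = word τ k := by
  rcases Nat.lt_or_ge n k with h | h
  · rw [word_of_gt _ h, word_of_gt _ (by omega)]
  · obtain ⟨k, rfl⟩ : ∃ l, k = l + 1 := ⟨k - 1, by omega⟩
    have h1 : p.succAbove ⟨k, by omega⟩ = ⟨k + 1, by omega⟩ := by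
      ext
      rw [val_succAbove, if_neg (by simp; omega)]
    have h2 := word_val_succ (insertPerm p (Fin.last n) τ) ⟨k + 1, by omega⟩
    have h3 := word_val_succ τ ⟨k, by omega⟩
    rw [← h1, insertPerm_succAbove, Fin.succAbove_last, h1] at h2
    exact h2.trans h3.symm

lemma word_insertPerm_self {n : ℕ} (p : Fin (n + 1)) (τ : Equiv.Perm (Fin n)) :
    word (insertPerm p (Fin.last n) τ) ((p : ℕ) + 1) = n + 1 := by
  rw [word_val_succ]
  simp

/-! ### Words with marked gaps. -/

section Marks

/-- The letter to the left of the letter `σ i` exceeds `u`, where every marked gap of the word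
of `σ` is thought of as containing an infinite letter. -/
def LeftGt {n : ℕ} (σ : Equiv.Perm (Fin n)) (S : Fin (n + 1) → Bool) (i : Fin n) (u : ℕ) : Prop :=
  S i.castSucc = true ∨ u < word σ i

/-- The letter to the right of the letter `σ i` exceeds `u`, where every marked gap of the word
of `σ` is thought of as containing an infinite letter. -/
def RightGt {n : ℕ} (σ : Equiv.Perm (Fin n)) (S : Fin (n + 1) → Bool) (i : Fin n) (u : ℕ) : Prop :=
  S i.succ = true ∨ u < word σ (i + 2)

instance {n : ℕ} (σ : Equiv.Perm (Fin n)) (S : Fin (n + 1) → Bool) (i : Fin n) (u : ℕ) :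
    Decidable (LeftGt σ S i u) := by unfold LeftGt; infer_instance

instance {n : ℕ} (σ : Equiv.Perm (Fin n)) (S : Fin (n + 1) → Bool) (i : Fin n) (u : ℕ) :
    Decidable (RightGt σ S i u) := by unfold RightGt; infer_instance

/-- The number of descents to the left of the letter `σ j` that straddle it. -/
def lesAt {n : ℕ} (σ : Equiv.Perm (Fin n)) (S : Fin (n + 1) → Bool) (j : Fin n) : ℕ :=
  ∑ i, if i < j ∧ σ i < σ j ∧ LeftGt σ S i (σ j + 1) then 1 else 0

/-- The number of ascents to the right of the letter `σ j` that straddle it. -/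
def resAt {n : ℕ} (σ : Equiv.Perm (Fin n)) (S : Fin (n + 1) → Bool) (j : Fin n) : ℕ :=
  ∑ i, if j < i ∧ σ i < σ j ∧ RightGt σ S i (σ j + 1) then 1 else 0

/-- The number of marked gaps. -/
def markCount {n : ℕ} (S : Fin n → Bool) : ℕ := ∑ k, if S k = true then 1 else 0

/-- The number of marked gaps on the left of the gap `p`. -/
def marksLeft {n : ℕ} (S : Fin n → Bool) (p : Fin n) : ℕ :=
  ∑ k, if k < p ∧ S k = true then 1 else 0

/-- The number of marked gaps on the right of the gap `p`. -/
def marksRight {n : ℕ} (S : Fin n → Bool) (p : Fin n) : ℕ :=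
  ∑ k, if p < k ∧ S k = true then 1 else 0

/-- The marked gaps, read from left to right, have `0, 1, 2, …` marks on their left, and the other
marks, apart from their own, on their right. -/
lemma sum_marks {R : Type*} [AddCommMonoid R] {n : ℕ} (S : Fin n → Bool) (f : ℕ → ℕ → R) :
    (∑ p, if S p = true then f (marksLeft S p) (marksRight S p) else 0) =
      ∑ a ∈ Finset.range (markCount S), f a (markCount S - 1 - a) := by
  induction n generalizing f with
  | zero => simp [markCount]
  | succ n ih =>
    have hL : ∀ p : Fin n, marksLeft S p.succ =
        (if S 0 = true then 1 else 0) + marksLeft (fun k => S k.succ) p := by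
      intro p
      rw [marksLeft, Fin.sum_univ_succ]
      simp [marksLeft]
    have hR : ∀ p : Fin n, marksRight S p.succ = marksRight (fun k => S k.succ) p := by
      intro p
      rw [marksRight, Fin.sum_univ_succ]
      simp [marksRight]
    have hL0 : marksLeft S 0 = 0 := by simp [marksLeft]
    have hR0 : marksRight S 0 = markCount (fun k => S k.succ) := by
      rw [marksRight, Fin.sum_univ_succ]
      simp [markCount]
    have hc : markCount S = (if S 0 = true then 1 else 0) + markCount (fun k => S k.succ) := by
      rw [markCount, Fin.sum_univ_succ, markCount]
    rw [Fin.sum_univ_succ]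
    simp only [hL, hR, hL0, hR0, hc]
    by_cases h0 : S 0 = true
    · simp only [h0, if_true]
      rw [ih (fun k => S k.succ) (fun a b => f (1 + a) b), add_comm 1 (markCount _),
        Finset.sum_range_succ', add_comm]
      congr 1
      refine Finset.sum_congr rfl fun a _ => ?_
      congr 1
      · omega
      · omega
    · simp only [h0, Bool.false_eq_true, if_false, zero_add]
      exact ih (fun k => S k.succ) f

variable {n : ℕ} (p : Fin (n + 1)) (b₀ b₁ : Bool) (T : Fin n → Bool)

/-- The marks after the gap `p` has been split into two gaps with marks `b₀` and `b₁`; the marks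
of the other gaps are `T`. -/
def splitMarks : Fin (n + 2) → Bool :=
  p.castSucc.insertNth (α := fun _ => Bool) b₀ (p.insertNth (α := fun _ => Bool) b₁ T)

/-- The marks `T` together with a mark at the gap `p`. -/
def addMark : Fin (n + 1) → Bool := p.insertNth (α := fun _ => Bool) true T

@[simp] lemma addMark_self : addMark p T p = true := by simp [addMark]

@[simp] lemma splitMarks_castSucc : splitMarks p b₀ b₁ T p.castSucc = b₀ := by simp [splitMarks]

@[simp] lemma splitMarks_succ : splitMarks p b₀ b₁ T p.succ = b₁ := by
  have : p.succ = p.castSucc.succAbove p := by simp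
  rw [this, splitMarks, Fin.insertNth_apply_succAbove, Fin.insertNth_apply_same]

lemma splitMarks_of_ne {k : Fin (n + 2)} {l : Fin (n + 1)}
    (h : (k : ℕ) = l ∧ (l : ℕ) < p ∨ (k : ℕ) = l + 1 ∧ (p : ℕ) < l) :
    splitMarks p b₀ b₁ T k = addMark p T l := by
  rcases Fin.eq_self_or_eq_succAbove p l with rfl | ⟨r, rfl⟩
  · omega
  · have : k = p.castSucc.succAbove (p.succAbove r) := by
      ext
      rw [val_succAbove]
      rw [val_succAbove] at h ⊢
      simp only [Fin.val_castSucc]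
      split_ifs at * <;> omega
    rw [this, splitMarks, addMark]
    simp only [Fin.insertNth_apply_succAbove]

lemma markCount_insertNth (b : Bool) :
    markCount (p.insertNth (α := fun _ => Bool) b T) =
      markCount T + if b = true then 1 else 0 := by
  rw [markCount, Fin.sum_univ_succAbove _ p, add_comm]
  simp only [Fin.insertNth_apply_succAbove, Fin.insertNth_apply_same, markCount]

lemma markCount_addMark : markCount (addMark p T) = markCount T + 1 :=
  markCount_insertNth p T true

lemma markCount_splitMarks : markCount (splitMarks p b₀ b₁ T) =
    markCount T + ((if b₀ = true then 1 else 0) + if b₁ = true then 1 else 0) := by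
  rw [splitMarks, markCount_insertNth, markCount_insertNth]
  ring

variable (τ : Equiv.Perm (Fin n))

/-- The inserted letter `n + 1` exceeds `u`, so it acts on its neighbours exactly as the infinite
letter that it replaces in the gap `p`. -/
lemma leftGt_insertPerm (i : Fin n) {u : ℕ} (hu : u ≤ n) :
    LeftGt (insertPerm p (Fin.last n) τ) (splitMarks p b₀ b₁ T) (p.succAbove i) u ↔
      LeftGt τ (addMark p T) i u := by
  unfold LeftGt
  rcases lt_trichotomy (i : ℕ) p with h | h | h
  · rw [val_succAbove, if_pos h, word_insertPerm_of_le _ _ h.le,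
      splitMarks_of_ne (l := i.castSucc)]
    left
    simp [val_succAbove, h]
  · have h1 : i.castSucc = p := Fin.ext h
    rw [val_succAbove, if_neg (by omega), h, word_insertPerm_self, h1, addMark_self]
    simp
    omega
  · rw [val_succAbove, if_neg (by omega), word_insertPerm_of_gt _ _ h,
      splitMarks_of_ne (l := i.castSucc)]
    right
    simp only [Fin.val_castSucc, val_succAbove]
    split_ifs <;> omega

lemma rightGt_insertPerm (i : Fin n) {u : ℕ} (hu : u ≤ n) :
    RightGt (insertPerm p (Fin.last n) τ) (splitMarks p b₀ b₁ T) (p.succAbove i) u ↔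
      RightGt τ (addMark p T) i u := by
  unfold RightGt
  rcases lt_trichotomy ((i : ℕ) + 1) p with h | h | h
  · rw [val_succAbove, if_pos (by omega), word_insertPerm_of_le _ _ (by omega),
      splitMarks_of_ne (l := i.succ)]
    left
    simp only [Fin.val_succ, val_succAbove]
    split_ifs <;> omega
  · have h1 : i.succ = p := Fin.ext (by simpa using h)
    rw [val_succAbove, if_pos (by omega), show (i : ℕ) + 2 = p + 1 by omega,
      word_insertPerm_self, h1, addMark_self]
    simp
    omega
  · rw [val_succAbove, if_neg (by omega), show (i : ℕ) + 1 + 2 = (i + 2) + 1 by omega,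
      word_insertPerm_of_gt _ _ (by omega), splitMarks_of_ne (l := i.succ)]
    right
    simp only [Fin.val_succ, val_succAbove]
    split_ifs <;> omega

lemma lesAt_insertPerm_succAbove (j : Fin n) :
    lesAt (insertPerm p (Fin.last n) τ) (splitMarks p b₀ b₁ T) (p.succAbove j) =
      lesAt τ (addMark p T) j := by
  rw [lesAt, Fin.sum_univ_succAbove _ p, lesAt, if_neg, zero_add]
  · refine Finset.sum_congr rfl fun i _ => ?_
    simp only [insertPerm_succAbove, Fin.succAbove_last, Fin.val_castSucc,
      Fin.succAbove_lt_succAbove_iff, Fin.castSucc_lt_castSucc_iff]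
    congr 2
    rw [leftGt_insertPerm _ _ _ _ _ _ (τ j).isLt]
  · rintro ⟨-, h, -⟩
    simp only [insertPerm_same, insertPerm_succAbove, Fin.lt_def] at h
    have := (Fin.succAbove (Fin.last n) (τ j)).isLt
    simp at h
    omega

lemma resAt_insertPerm_succAbove (j : Fin n) :
    resAt (insertPerm p (Fin.last n) τ) (splitMarks p b₀ b₁ T) (p.succAbove j) =
      resAt τ (addMark p T) j := by
  rw [resAt, Fin.sum_univ_succAbove _ p, resAt, if_neg, zero_add]
  · refine Finset.sum_congr rfl fun i _ => ?_
    simp only [insertPerm_succAbove, Fin.succAbove_last, Fin.val_castSucc,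
      Fin.succAbove_lt_succAbove_iff, Fin.castSucc_lt_castSucc_iff]
    congr 2
    rw [rightGt_insertPerm _ _ _ _ _ _ (τ j).isLt]
  · rintro ⟨-, h, -⟩
    simp only [insertPerm_same, insertPerm_succAbove, Fin.lt_def] at h
    have := (Fin.succAbove (Fin.last n) (τ j)).isLt
    simp at h
    omega

/-- Only infinite letters exceed the inserted one, and every marked gap to its left contributes one
descent from such a letter. -/
lemma lesAt_insertPerm_self :
    lesAt (insertPerm p (Fin.last n) τ) (splitMarks p b₀ b₁ T) p = marksLeft (addMark p T) p := by
  rw [lesAt, Fin.sum_univ_succAbove _ p, marksLeft, Fin.sum_univ_castSucc, if_neg (by simp),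
    zero_add, if_neg (c := Fin.last n < p ∧ _) (fun h => absurd (Fin.le_last p) (not_le.2 h.1)),
    add_zero]
  refine Finset.sum_congr rfl fun i _ => ?_
  congr 1
  have hw := word_le (insertPerm p (Fin.last n) τ) (p.succAbove i)
  simp only [insertPerm_same, insertPerm_succAbove, Fin.succAbove_last, Fin.castSucc_lt_last,
    true_and, LeftGt, Fin.val_last, eq_iff_iff, not_lt.2 hw, or_false]
  by_cases h : (i : ℕ) < p
  · have h1 : p.succAbove i < p := by rw [Fin.lt_def, val_succAbove, if_pos h]; exact h
    have h2 : i.castSucc < p := h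
    simp only [h1, h2, true_and]
    rw [splitMarks_of_ne (l := i.castSucc)]
    left
    simp [val_succAbove, h]
  · have h1 : ¬ p.succAbove i < p := by rw [Fin.lt_def, val_succAbove, if_neg h]; omega
    have h2 : ¬ i.castSucc < p := h
    simp only [h1, h2, false_and]

lemma resAt_insertPerm_self :
    resAt (insertPerm p (Fin.last n) τ) (splitMarks p b₀ b₁ T) p =
      marksRight (addMark p T) p := by
  rw [resAt, Fin.sum_univ_succAbove _ p, marksRight, Fin.sum_univ_succ, if_neg (by simp),
    zero_add, if_neg (c := p < 0 ∧ _) (fun h => absurd (Fin.zero_le p) (not_le.2 h.1)), zero_add]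
  refine Finset.sum_congr rfl fun i _ => ?_
  congr 1
  have hw := word_le (insertPerm p (Fin.last n) τ) (p.succAbove i + 2)
  simp only [insertPerm_same, insertPerm_succAbove, Fin.succAbove_last, Fin.castSucc_lt_last,
    true_and, RightGt, Fin.val_last, eq_iff_iff, not_lt.2 hw, or_false]
  by_cases h : (i : ℕ) < p
  · have h1 : ¬ p < p.succAbove i := by rw [Fin.lt_def, val_succAbove, if_pos h]; omega
    have h2 : ¬ p < i.succ := by rw [Fin.lt_def, Fin.val_succ]; omega
    simp only [h1, h2, false_and]
  · have h1 : p < p.succAbove i := by rw [Fin.lt_def, val_succAbove, if_neg h]; omega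
    have h2 : p < i.succ := by rw [Fin.lt_def, Fin.val_succ]; omega
    simp only [h1, h2, true_and]
    rw [splitMarks_of_ne (l := i.succ)]
    right
    simp only [Fin.val_succ, val_succAbove]
    split_ifs
    omega

end Marks

/-! ### Summing over marked words. -/

section MarkedSum

variable {R : Type*} [CommRing R] (q x y : R)

/-- The weight of a letter with a larger letter on its left (if `b₀`) and on its right
(if `b₁`): `x` for a valley, `y` for a double ascent, `1` for a peak, `0` for a double descent. -/
def shapeWeight (b₀ b₁ : Bool) : R :=
  if b₀ then (if b₁ then x else 0) else if b₁ then y else 1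

/-- The weight of the word of a permutation with marked gaps. -/
def markedWeight {n : ℕ} (σ : Equiv.Perm (Fin n)) (S : Fin (n + 1) → Bool) : R :=
  ∏ j, shapeWeight x y (LeftGt σ S j (σ j + 1)) (RightGt σ S j (σ j + 1)) *
    q ^ (2 * resAt σ S j + lesAt σ S j)

lemma markedWeight_insertPerm {n : ℕ} (p : Fin (n + 1)) (b₀ b₁ : Bool) (T : Fin n → Bool)
    (τ : Equiv.Perm (Fin n)) :
    markedWeight q x y (insertPerm p (Fin.last n) τ) (splitMarks p b₀ b₁ T) =
      shapeWeight x y b₀ b₁ *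
        q ^ (2 * marksRight (addMark p T) p + marksLeft (addMark p T) p) *
        markedWeight q x y τ (addMark p T) := by
  rw [markedWeight, Fin.prod_univ_succAbove _ p, markedWeight]
  congr 1
  · rw [lesAt_insertPerm_self, resAt_insertPerm_self]
    have hl := word_le (insertPerm p (Fin.last n) τ) p
    have hr := word_le (insertPerm p (Fin.last n) τ) (p + 2)
    simp [LeftGt, RightGt, not_lt.2 hl, not_lt.2 hr]
  · refine Finset.prod_congr rfl fun j _ => ?_
    rw [lesAt_insertPerm_succAbove, resAt_insertPerm_succAbove]
    simp only [insertPerm_succAbove, Fin.succAbove_last, Fin.val_castSucc,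
      leftGt_insertPerm p b₀ b₁ T τ j (τ j).isLt, rightGt_insertPerm p b₀ b₁ T τ j (τ j).isLt]

/-- The generating function of the completions, by `m` larger letters, of a word with `B` marked
gaps. -/
def completionSum : ℕ → ℕ → R
  | 0, B => if B = 0 then 1 else 0
  | m + 1, B => (∑ a ∈ Finset.range B, q ^ (2 * (B - 1 - a) + a)) *
      (completionSum m (B - 1) + y * completionSum m B + x * completionSum m (B + 1))

/-- The sum of the weights of all completions, by `m` larger letters, of all words of length
`n` with marked gaps. -/
def markedSum (n m : ℕ) : R :=
  ∑ σ : Equiv.Perm (Fin n), ∑ S : Fin (n + 1) → Bool,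
    markedWeight q x y σ S * completionSum q x y m (markCount S)

lemma sum_insertNth {M : Type*} [AddCommMonoid M] {n : ℕ} (p : Fin (n + 1))
    (f : (Fin (n + 1) → Bool) → M) :
    ∑ S, f S = ∑ b, ∑ T : Fin n → Bool, f (p.insertNth (α := fun _ => Bool) b T) := by
  rw [← Fintype.sum_prod_type']
  exact (Fintype.sum_equiv (Fin.insertNthEquiv (fun _ => Bool) p) _ _ fun _ => rfl).symm

lemma sum_splitMarks {M : Type*} [AddCommMonoid M] {n : ℕ} (p : Fin (n + 1))
    (f : (Fin (n + 2) → Bool) → M) :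
    ∑ S, f S = ∑ T : Fin n → Bool, ∑ b₀, ∑ b₁, f (splitMarks p b₀ b₁ T) := by
  rw [sum_insertNth p.castSucc, Finset.sum_comm (s := (Finset.univ : Finset (Fin n → Bool)))]
  refine Finset.sum_congr rfl fun b₀ _ => ?_
  rw [sum_insertNth p, Finset.sum_comm]
  rfl

lemma sum_addMark {M : Type*} [AddCommMonoid M] {n : ℕ} (p : Fin (n + 1))
    (f : (Fin (n + 1) → Bool) → M) :
    (∑ S, if S p = true then f S else 0) = ∑ T : Fin n → Bool, f (addMark p T) := by
  rw [sum_insertNth p]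
  simp [addMark]

/-- Unfolding one step of `completionSum` chooses a marked gap, which receives the next letter; the
marks of the two resulting gaps fix the shape of that letter. -/
lemma markedSum_succ (n m : ℕ) : markedSum q x y (n + 1) m = markedSum q x y n (m + 1) := by
  rw [markedSum, sum_perm_insert_value (Fin.last n), Finset.sum_comm, markedSum]
  refine Finset.sum_congr rfl fun τ _ => ?_
  have h1 : ∀ S : Fin (n + 1) → Bool,
      markedWeight q x y τ S * completionSum q x y (m + 1) (markCount S) =
      ∑ p, if S p = true then q ^ (2 * marksRight S p + marksLeft S p) *
        (markedWeight q x y τ S * (completionSum q x y m (markCount S - 1) +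
          y * completionSum q x y m (markCount S) +
          x * completionSum q x y m (markCount S + 1))) else 0 := by
    intro S
    have := sum_marks S (fun a b => q ^ (2 * b + a))
    rw [completionSum, ← this, Finset.sum_mul, Finset.mul_sum]
    refine Finset.sum_congr rfl fun p _ => ?_
    split_ifs
    · ring
    · ring
  rw [Finset.sum_congr rfl fun S _ => h1 S]
  conv_rhs => rw [Finset.sum_comm]
  refine Finset.sum_congr rfl fun p _ => ?_
  rw [sum_addMark p, sum_splitMarks p]
  refine Finset.sum_congr rfl fun T _ => ?_
  simp only [markedWeight_insertPerm, markCount_splitMarks, markCount_addMark, Fintype.sum_bool,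
    shapeWeight]
  simp
  ring

lemma markedSum_eq (n m : ℕ) : markedSum q x y n m = markedSum q x y 0 (n + m) := by
  induction n generalizing m with
  | zero => rw [zero_add]
  | succ n ih => rw [markedSum_succ, ih, show n + (m + 1) = n + 1 + m by ring]

/-- With no letters left to insert, no gap may remain marked. -/
lemma markedSum_zero_right (n : ℕ) :
    markedSum q x y n 0 = ∑ σ : Equiv.Perm (Fin n), markedWeight q x y σ fun _ => false := by
  refine Finset.sum_congr rfl fun σ _ => ?_
  rw [Finset.sum_eq_single (fun _ => false)]
  · simp [completionSum, markCount]
  · intro S _ hS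
    have : markCount S ≠ 0 := by
      intro h
      apply hS
      funext k
      have := (Finset.sum_eq_zero_iff.1 h) k (Finset.mem_univ k)
      simpa using this
    rw [completionSum, if_neg this, mul_zero]
  · simp

lemma sum_range_eq_stepWeight (h : ℕ) :
    ∑ a ∈ Finset.range (h + 1), q ^ (2 * (h + 1 - 1 - a) + a) = stepWeight q h := by
  rw [stepWeight, Finset.mul_sum, ← Finset.sum_range_reflect]
  refine Finset.sum_congr rfl fun a ha => ?_
  rw [Finset.mem_range] at ha
  rw [← pow_add]
  congr 1
  omega

lemma completionSum_eq_motzkinSum (m h : ℕ) : completionSum q x y (m + 1) (h + 1) =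
    (∏ i ∈ Finset.range (h + 1), stepWeight q i) * motzkinSum q x y m h := by
  induction m generalizing h with
  | zero =>
    rw [completionSum, sum_range_eq_stepWeight]
    cases h with
    | zero => simp [completionSum, motzkinSum]
    | succ h => simp [completionSum, motzkinSum]
  | succ m ih =>
    rw [completionSum, sum_range_eq_stepWeight, ih, ih]
    cases h with
    | zero =>
      simp only [Finset.prod_range_succ, Finset.prod_range_zero, motzkinSum]
      rw [completionSum]
      simp
      ring
    | succ h =>
      rw [Nat.add_sub_cancel, ih, motzkinSum]
      simp only [Finset.prod_range_succ]
      ring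

/-- Everything is transported to the empty word, whose only gap must be marked: one mark is height
`0`. -/
lemma sum_markedWeight (m : ℕ) :
    ∑ σ : Equiv.Perm (Fin (m + 1)), markedWeight q x y σ (fun _ => false) =
      motzkinSum q x y m 0 := by
  rw [← markedSum_zero_right, markedSum_eq, markedSum, Fintype.sum_unique,
    sum_insertNth (0 : Fin 1)]
  have h0 : completionSum q x y (m + 1) 0 = 0 := by
    rw [completionSum, Finset.sum_range_zero, zero_mul]
  have h1 := completionSum_eq_motzkinSum q x y m 0
  have h2 : ∀ T : Fin 0 → Bool, markCount T = 0 := fun T => by simp [markCount]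
  simp only [Fintype.sum_bool, Fintype.sum_unique, markCount_insertNth, markedWeight,
    Finset.univ_eq_empty, Finset.prod_empty, one_mul, if_true, Bool.false_eq_true, if_false, h2,
    add_zero, h0, h1]
  simp [stepWeight]

end MarkedSum

/-! ### The weight of an unmarked word in terms of `des`, `les` and `res`. -/

section Words

variable {n : ℕ} (σ : Equiv.Perm (Fin n))

lemma sum_Icc_eq_sum_fin {M : Type*} [AddCommMonoid M] (f : ℕ → M) :
    ∑ a ∈ Finset.Icc 1 n, f a = ∑ i : Fin n, f (i + 1) := by
  rw [Fin.sum_univ_eq_sum_range (fun i => f (i + 1)), Finset.range_eq_Ico,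
    Finset.sum_Ico_add' (fun i => f i)]
  rfl

lemma sum_lesAt : ∑ j, lesAt σ (fun _ => false) j = les σ := by
  have h : (Finset.Icc 2 n ×ˢ Finset.Icc 2 n).filter (fun p : ℕ × ℕ => p.1 < p.2 ∧
      word σ (p.1 - 1) > word σ p.2 ∧ word σ p.2 > word σ p.1) =
      (Finset.Icc 1 n ×ˢ Finset.Icc 1 n).filter fun p : ℕ × ℕ => p.1 < p.2 ∧
        word σ (p.1 - 1) > word σ p.2 ∧ word σ p.2 > word σ p.1 := by
    ext ⟨a, b⟩
    simp only [Finset.mem_filter, Finset.mem_product, Finset.mem_Icc]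
    constructor
    · rintro ⟨h1, h2⟩
      exact ⟨by omega, h2⟩
    · rintro ⟨h1, h2⟩
      refine ⟨?_, h2⟩
      -- The letter to the left of position `1` is `0`, so nothing is lost by starting at `2`.
      have : a ≠ 1 := by
        rintro rfl
        simp at h2
      omega
  rw [les, h, Finset.card_filter, Finset.sum_product_right, sum_Icc_eq_sum_fin]
  refine Finset.sum_congr rfl fun j _ => ?_
  rw [sum_Icc_eq_sum_fin, lesAt]
  refine Finset.sum_congr rfl fun i _ => ?_
  congr 1
  simp only [LeftGt, word_val_succ, Nat.add_sub_cancel, Fin.lt_def, Bool.false_eq_true, false_or,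
    eq_iff_iff]
  omega

lemma sum_resAt : ∑ j, resAt σ (fun _ => false) j = res σ := by
  have h : (Finset.Ico 1 n ×ˢ Finset.Ico 1 n).filter (fun p : ℕ × ℕ => p.1 < p.2 ∧
      word σ (p.2 + 1) > word σ p.1 ∧ word σ p.1 > word σ p.2) =
      (Finset.Icc 1 n ×ˢ Finset.Icc 1 n).filter fun p : ℕ × ℕ => p.1 < p.2 ∧
        word σ (p.2 + 1) > word σ p.1 ∧ word σ p.1 > word σ p.2 := by
    ext ⟨a, b⟩
    simp only [Finset.mem_filter, Finset.mem_product, Finset.mem_Icc, Finset.mem_Ico]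
    constructor
    · rintro ⟨h1, h2⟩
      exact ⟨by omega, h2⟩
    · rintro ⟨h1, h2⟩
      refine ⟨?_, h2⟩
      have : b ≠ n := by
        rintro rfl
        rw [word_of_gt σ (Nat.lt_succ_self _)] at h2
        omega
      omega
  rw [res, h, Finset.card_filter, Finset.sum_product, sum_Icc_eq_sum_fin]
  refine Finset.sum_congr rfl fun j _ => ?_
  rw [sum_Icc_eq_sum_fin, resAt]
  refine Finset.sum_congr rfl fun i _ => ?_
  congr 1
  simp only [RightGt, word_val_succ, Fin.lt_def, Bool.false_eq_true, false_or,
    eq_iff_iff, add_assoc, Nat.reduceAdd]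
  omega

lemma word_ne_word_succ {k : ℕ} (hk : k < n) : word σ (k + 1) ≠ word σ (k + 2) := by
  rw [word_val_succ σ ⟨k, hk⟩]
  by_cases h : k + 1 < n
  · rw [word_val_succ σ ⟨k + 1, h⟩]
    intro e
    have := σ.injective (Fin.ext (Nat.succ_injective e))
    simp at this
  · rw [word_of_gt σ (by omega)]
    omega

/-- The indicator of a descent of the word `0 σ(1) … σ(n) 0` at the position `k`. -/
def descentAt (k : ℕ) : ℕ := if word σ (k + 1) < word σ k then 1 else 0

lemma descentAt_zero : descentAt σ 0 = 0 := by simp [descentAt]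

lemma sum_descentAt : ∑ i : Fin n, descentAt σ i = des σ := by
  rw [Fin.sum_univ_eq_sum_range (descentAt σ), des, Finset.card_filter]
  cases n with
  | zero => simp
  | succ n =>
    rw [Finset.range_eq_Ico, Finset.sum_eq_sum_Ico_succ_bot (by omega), descentAt_zero, zero_add]
    rfl

/-- The extra descent is the one from the last letter to the final `0`. -/
lemma sum_descentAt_succ (hn : 1 ≤ n) : ∑ i : Fin n, descentAt σ (i + 1) = des σ + 1 := by
  have h1 : descentAt σ n = 1 := by
    obtain ⟨n, rfl⟩ : ∃ l, n = l + 1 := ⟨n - 1, by omega⟩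
    rw [descentAt, word_of_gt σ (Nat.lt_succ_self _), if_pos]
    exact (word_val_succ σ (Fin.last n)).symm ▸ Nat.succ_pos _
  have h2 := Finset.sum_range_succ (descentAt σ) n
  rw [Finset.sum_range_succ', descentAt_zero, h1, ← Fin.sum_univ_eq_sum_range (descentAt σ) n,
    sum_descentAt] at h2
  rw [Fin.sum_univ_eq_sum_range (fun i => descentAt σ (i + 1))]
  omega

lemma ddZero_eq_zero_iff :
    ddZero σ = 0 ↔ ∀ i : Fin n, descentAt σ i + descentAt σ (i + 1) ≤ 1 := by
  rw [ddZero, Finset.card_eq_zero, Finset.filter_eq_empty_iff]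
  unfold descentAt
  constructor
  · intro h i
    rcases Nat.eq_zero_or_pos (i : ℕ) with h0 | h0
    · rw [h0]
      simp
      split_ifs <;> omega
    · have := h (x := i + 1) (Finset.mem_Icc.2 ⟨by omega, by omega⟩)
      rw [Nat.add_sub_cancel] at this
      split_ifs <;> omega
  · intro h i hi
    rw [Finset.mem_Icc] at hi
    obtain ⟨i, rfl⟩ : ∃ l, i = l + 1 := ⟨i - 1, by omega⟩
    have := h ⟨i, by omega⟩
    rw [Nat.add_sub_cancel]
    simp only at this
    split_ifs at this <;> omega

/-- Without double descents each letter has at most one adjacent descent. Left descents number `des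
σ`, right descents `des σ + 1`, and the remaining letters are the double ascents. -/
lemma two_mul_des_add_sum (hn : 1 ≤ n) (h : ddZero σ = 0) :
    (∑ i : Fin n, (1 - (descentAt σ i + descentAt σ (i + 1)))) + 2 * des σ + 1 = n := by
  have h1 : ∑ i : Fin n, ((1 - (descentAt σ i + descentAt σ (i + 1))) +
      (descentAt σ i + descentAt σ (i + 1))) = ∑ _i : Fin n, 1 :=
    Finset.sum_congr rfl fun i _ => Nat.sub_add_cancel ((ddZero_eq_zero_iff σ).1 h i)
  rw [Finset.sum_add_distrib, Finset.sum_add_distrib, sum_descentAt, sum_descentAt_succ σ hn] at h1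
  simp at h1
  omega

lemma markedWeight_no_marks {R : Type*} [CommRing R] (q x y : R) (hn : 1 ≤ n) :
    markedWeight q x y σ (fun _ => false) = if ddZero σ = 0 then
      x ^ des σ * y ^ (n - 1 - 2 * des σ) * q ^ (2 * res σ + les σ) else 0 := by
  have hL : ∀ i : Fin n, LeftGt σ (fun _ => false) i (σ i + 1) ↔ descentAt σ i = 1 := by
    intro i
    simp [LeftGt, descentAt, word_val_succ]
  have hR : ∀ i : Fin n, RightGt σ (fun _ => false) i (σ i + 1) ↔ descentAt σ (i + 1) = 0 := by
    intro i
    have h1 := word_ne_word_succ σ i.isLt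
    have h2 := word_val_succ σ i
    simp only [RightGt, descentAt, Bool.false_eq_true, false_or, add_assoc, Nat.reduceAdd]
    split_ifs <;> simp only [iff_false, iff_true] <;> omega
  have hle : ∀ k, descentAt σ k ≤ 1 := by
    intro k
    unfold descentAt
    split_ifs <;> omega
  split_ifs with h
  · have hs := two_mul_des_add_sum σ hn h
    rw [show n - 1 - 2 * des σ = ∑ i : Fin n, (1 - (descentAt σ i + descentAt σ (i + 1))) by omega,
      ← sum_descentAt, ← sum_lesAt, ← sum_resAt, Finset.mul_sum, ← Finset.sum_add_distrib,
      ← Finset.prod_pow_eq_pow_sum, ← Finset.prod_pow_eq_pow_sum, ← Finset.prod_pow_eq_pow_sum,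
      ← Finset.prod_mul_distrib, ← Finset.prod_mul_distrib]
    refine Finset.prod_congr rfl fun i _ => ?_
    congr 1
    have h1 := (ddZero_eq_zero_iff σ).1 h i
    have hLi := hL i
    have hRi := hR i
    generalize descentAt σ i = a at *
    generalize descentAt σ (i + 1) = b at *
    -- In order: double ascent, valley, peak.
    have : a = 0 ∧ b = 0 ∨ a = 1 ∧ b = 0 ∨ a = 0 ∧ b = 1 := by omega
    rcases this with ⟨rfl, rfl⟩ | ⟨rfl, rfl⟩ | ⟨rfl, rfl⟩ <;>
      simp_all [shapeWeight]
  · rw [ddZero_eq_zero_iff] at h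
    push Not at h
    obtain ⟨i, hi⟩ := h
    refine Finset.prod_eq_zero (Finset.mem_univ i) ?_
    have h1 := hle i
    have h2 := hle (i + 1)
    have hLi : LeftGt σ (fun _ => false) i (σ i + 1) := (hL i).2 (by omega)
    have hRi : ¬ RightGt σ (fun _ => false) i (σ i + 1) := fun hc => by
      have := (hR i).1 hc
      omega
    simp [shapeWeight, hLi, hRi]

lemma des_le_of_ddZero (hn : 1 ≤ n) (h : ddZero σ = 0) : des σ ≤ (n - 1) / 2 := by
  have := two_mul_des_add_sum σ hn h
  omega

end Words

/-! ### The γ-expansion and divisibility. -/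

lemma motzkinSum_eq_sum_gammaPoly {n : ℕ} (hn : 1 ≤ n) (y : ℤ[X][X]) :
    motzkinSum (C X) X y (n - 1) 0 = ∑ k ∈ Finset.range ((n - 1) / 2 + 1),
      C (gammaPoly n k) * (X : ℤ[X][X]) ^ k * y ^ (n - 1 - 2 * k) := by
  obtain ⟨n, rfl⟩ : ∃ l, n = l + 1 := ⟨n - 1, by omega⟩
  rw [Nat.add_sub_cancel, ← sum_markedWeight]
  simp only [markedWeight_no_marks _ _ _ _ hn]
  rw [← Finset.sum_filter, ← Finset.sum_fiberwise_of_maps_to (g := des)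
    (t := Finset.range (n / 2 + 1))]
  · refine Finset.sum_congr rfl fun k _ => ?_
    rw [gammaPoly, map_sum, Finset.sum_mul, Finset.sum_mul, DD, Finset.filter_filter]
    refine Finset.sum_congr (Finset.filter_congr fun σ _ => and_comm) fun σ hσ => ?_
    rw [(Finset.mem_filter.1 hσ).2.1, map_pow, Nat.add_sub_cancel]
    ring
  · intro σ hσ
    have := des_le_of_ddZero σ hn (Finset.mem_filter.1 hσ).2
    rw [Finset.mem_range]
    omega

lemma one_add_X_dvd_geom_sum (j : ℕ) :
    (1 + X : ℤ[X]) ∣ ∑ r ∈ Finset.range (2 * j), X ^ r := by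
  induction j with
  | zero => simp
  | succ j ih =>
    rw [show 2 * (j + 1) = 2 * j + 1 + 1 by ring, Finset.sum_range_succ, Finset.sum_range_succ,
      add_assoc]
    exact dvd_add ih ⟨X ^ (2 * j), by ring⟩

/-- One of `h + 1`, `h + 2` is even, so one geometric sum is divisible by `1 + X`; the prefactors
multiply to `X ^ (2 * h + 1)`. -/
lemma dvd_stepWeight_mul (h : ℕ) :
    (X * (1 + X) : ℤ[X]) ∣ stepWeight X h * stepWeight X (h + 1) := by
  have h1 : (1 + X : ℤ[X]) ∣ (∑ r ∈ Finset.range (h + 1), X ^ r) *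
      ∑ r ∈ Finset.range (h + 1 + 1), X ^ r := by
    rcases Nat.even_or_odd' (h + 1) with ⟨j, hj | hj⟩
    · rw [hj]
      exact (one_add_X_dvd_geom_sum j).mul_right _
    · rw [show h + 1 + 1 = 2 * (j + 1) by omega]
      exact (one_add_X_dvd_geom_sum (j + 1)).mul_left _
  obtain ⟨w, hw⟩ := h1
  refine ⟨X ^ (2 * h) * w, ?_⟩
  rw [stepWeight, stepWeight]
  linear_combination (X ^ (2 * h) * X) * hw

lemma stepWeight_C (h : ℕ) : stepWeight (C X : ℤ[X][X]) h = C (stepWeight X h) := by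
  simp [stepWeight]

/-- Only up steps carry the outer variable, and each brings a factor divisible by `X * (1 + X)`. -/
lemma dvd_coeff_motzkinSum (m h k : ℕ) :
    (X * (1 + X) : ℤ[X]) ^ k ∣ (motzkinSum (C X) X (1 : ℤ[X][X]) m h).coeff k := by
  have hU : ∀ (M : ℤ[X][X]) (w : ℤ[X]), (X * (1 + X) : ℤ[X]) ∣ w →
      (∀ k, (X * (1 + X) : ℤ[X]) ^ k ∣ M.coeff k) →
      ∀ k, (X * (1 + X) : ℤ[X]) ^ k ∣ ((X : ℤ[X][X]) * C w * M).coeff k := by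
    intro M w hw hM k
    rw [mul_assoc]
    cases k with
    | zero => simp
    | succ k =>
      rw [coeff_X_mul, coeff_C_mul, pow_succ']
      exact mul_dvd_mul hw (hM k)
  have hLevel : ∀ (M : ℤ[X][X]) (w : ℤ[X]), (∀ k, (X * (1 + X) : ℤ[X]) ^ k ∣ M.coeff k) →
      ∀ k, (X * (1 + X) : ℤ[X]) ^ k ∣ (C w * M).coeff k := by
    intro M w hM k
    rw [coeff_C_mul]
    exact (hM k).mul_left _
  induction m generalizing h k with
  | zero =>
    rw [motzkinSum]
    split_ifs
    · cases k <;> simp [coeff_one]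
    · simp
  | succ m ih =>
    cases h with
    | zero =>
      rw [motzkinSum, coeff_add, one_mul]
      simp only [stepWeight_C, ← C_mul]
      exact dvd_add (hLevel _ _ (ih 0) k) (hU _ _ (dvd_stepWeight_mul 0) (ih 1) k)
    | succ h =>
      rw [motzkinSum, coeff_add, coeff_add, one_mul]
      simp only [stepWeight_C, ← C_mul]
      exact dvd_add (dvd_add (ih h k) (hLevel _ _ (ih _) k))
        (hU _ _ (dvd_stepWeight_mul (h + 1)) (ih _) k)

lemma coeff_sum_C_mul_X_pow (f : ℕ → ℤ[X]) (N k : ℕ) (hk : k < N) :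
    (∑ i ∈ Finset.range N, C (f i) * (X : ℤ[X][X]) ^ i).coeff k = f k := by
  simp [coeff_C_mul, coeff_X_pow, hk]

theorem theorem1 (n : ℕ) (hn : 1 ≤ n) :
    (∀ σ : Equiv.Perm (Fin n), exc σ ≤ inv σ) ∧
    (∑ σ : Equiv.Perm (Fin n), (X : ℤ[X][X]) ^ exc σ * C ((X : ℤ[X]) ^ (inv σ - exc σ)) =
      ∑ k ∈ Finset.range ((n - 1) / 2 + 1),
        C (gammaPoly n k) * (X : ℤ[X][X]) ^ k * (1 + X) ^ (n - 1 - 2 * k)) ∧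
    (∀ k : ℕ, k ≤ (n - 1) / 2 → (X : ℤ[X]) ^ k * (1 + X) ^ k ∣ gammaPoly n k) := by
  refine ⟨exc_le_inv, ?_, fun k hk => ?_⟩
  · rw [← motzkinSum_eq_sum_gammaPoly hn]
    obtain ⟨n, rfl⟩ : ∃ l, n = l + 1 := ⟨n - 1, by omega⟩
    rw [Nat.add_sub_cancel, ← sum_exc_inv_eq_motzkinSum]
    simp only [map_pow]
  -- At `y = 1` the powers of `y` disappear and the coefficient is `gammaPoly n k` itself.
  · have h1 := dvd_coeff_motzkinSum (n - 1) 0 k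
    rw [motzkinSum_eq_sum_gammaPoly hn] at h1
    simp only [one_pow, mul_one] at h1
    rwa [coeff_sum_C_mul_X_pow _ _ _ (by omega), mul_pow] at h1
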